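/- Let $\mathcal H$ be a finite-dimensional complex Hilbert space, $\mathcal L(\mathcal H)$ the algebra of linear operators on $\mathcal H$, and $Q\in\mathcal L(\mathcal H)$ an orthogonal projection with compression map $\mathcal P_Q(X)=QXQ$. Identify $\mathcal L(Q\mathcal H)$ with $Q\mathcal L(\mathcal H)Q\subseteq\mathcal L(\mathcal H)$. Let $\Phi:\mathcal L(\mathcal H)\to\mathcal L(\mathcal H)$ be a channel, i.e. a completely positive trace-preserving linear map, and let $\Phi^\dagger$ be its dual map, defined by $\operatorname{tr}(\Phi(\rho)X)=\operatorname{tr}(\rho\,\Phi^\dagger(X))$ for all $\rho,X\in\mathcal L(\mathcal H)$. Let $\mathcal A$ be a (not necessarily unital) subalgebra of $\mathcal L(Q\mathcal H)$. It is called private for $\Phi$ with respect to $Q$ if $$\mathcal P_Q(\Phi^\dagger(\mathcal L(\mathcal H)))\subseteq\{X\in\mathcal L(Q\mathcal H) : XA=AX \text{ for all } A\in\mathcal A\}.$$ Theorem. $\mathcal A$ is private for $\Phi$ with respect to $Q$ if and only if $$\mathcal A\subseteq\big((\ker(\Phi\circ\mathcal P_Q))^{\perp}\big)',$$ where $\ker(\Phi\circ\mathcal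 P_Q)\subseteq\mathcal L(\mathcal H)$, $\perp$ is the orthogonal complement in $\mathcal L(\mathcal H)$ for the trace inner product $\langle X,Y\rangle=\operatorname{tr}(X^*Y)$, and $'$ is the commutant in $\mathcal L(\mathcal H)$. -/

import Mathlib

namespace PrivateAlgebra

noncomputable section

variable {H : Type*} [NormedAddCommGroup H] [InnerProductSpace ℂ H]

/-- The trace of an operator on a finite-dimensional Hilbert space, as a linear functional. -/
def tr : (H →L[ℂ] H) →ₗ[ℂ] ℂ :=
  LinearMap.trace ℂ H ∘ₗ ContinuousLinearMap.coeLM ℂ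

/-- The bilinear trace pairing `(X, Y) ↦ tr (X Y)` on `L(H)`. -/
def tracePairing : LinearMap.BilinForm ℂ (H →L[ℂ] H) :=
  (LinearMap.mul ℂ (H →L[ℂ] H)).compr₂ tr

theorem tracePairing_apply (X Y : H →L[ℂ] H) : tracePairing X Y = tr (X * Y) := rfl

theorem tr_mul_comm (X Y : H →L[ℂ] H) : tr (X * Y) = tr (Y * X) :=
  LinearMap.trace_mul_comm ℂ (X : H →ₗ[ℂ] H) (Y : H →ₗ[ℂ] H)

theorem tracePairing_nondegenerate [FiniteDimensional ℂ H] :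
    (tracePairing : LinearMap.BilinForm ℂ (H →L[ℂ] H)).Nondegenerate := by
  have hsymm : (tracePairing : LinearMap.BilinForm ℂ (H →L[ℂ] H)).IsRefl := by
    intro X Y h
    rw [tracePairing_apply, tr_mul_comm] at h
    exact h
  refine hsymm.nondegenerate_iff_separatingLeft.mpr ?_
  intro X hX
  ext v
  rw [zero_apply, ← inner_self_eq_zero (𝕜 := ℂ)]
  have h := hX ((innerSL ℂ (X v)).smulRight v)
  have e : ((X * (innerSL ℂ (X v)).smulRight v : H →L[ℂ] H) : H →ₗ[ℂ] H) =
      ((innerSL ℂ (X v) : H →L[ℂ] ℂ) : H →ₗ[ℂ] ℂ).smulRight (X v) := by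
    ext w
    simp
  have h' : LinearMap.trace ℂ H
      ((X * (innerSL ℂ (X v)).smulRight v : H →L[ℂ] H) : H →ₗ[ℂ] H) = 0 := h
  rw [e, LinearMap.trace_smulRight] at h'
  simpa using h'

/-- The dual map `Φ†`, defined by `tr (Φ(ρ) X) = tr (ρ Φ†(X))`; see `tr_mul_dualMap`. -/
def dualMap [FiniteDimensional ℂ H] (Φ : (H →L[ℂ] H) →ₗ[ℂ] (H →L[ℂ] H)) :
    (H →L[ℂ] H) →ₗ[ℂ] (H →L[ℂ] H) :=
  tracePairing.leftAdjointOfNondegenerate tracePairing_nondegenerate Φ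

theorem tr_mul_dualMap [FiniteDimensional ℂ H] (Φ : (H →L[ℂ] H) →ₗ[ℂ] (H →L[ℂ] H))
    (ρ X : H →L[ℂ] H) : tr (Φ ρ * X) = tr (ρ * dualMap Φ X) := by
  have h := LinearMap.BilinForm.isAdjointPairLeftAdjointOfNondegenerate
    (tracePairing (H := H)) tracePairing_nondegenerate Φ X ρ
  rw [tracePairing_apply, tracePairing_apply] at h
  rw [tr_mul_comm, tr_mul_comm ρ]
  exact h.symm

/-- The compression map `P_Q(X) = Q X Q` on `L(H)`. -/
def compression (Q : H →L[ℂ] H) : (H →L[ℂ] H) →ₗ[ℂ] (H →L[ℂ] H) :=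
  LinearMap.mulLeftRight ℂ (Q, Q)

/-- `L(QH)`, for a projection `Q`, realized as the corner `Q L(H) Q` of `L(H)`: the operators
on `H` that map `QH` to itself and vanish on the orthogonal complement of `QH`. -/
def compressedOperators (Q : H →L[ℂ] H) : Set (H →L[ℂ] H) :=
  {X | Q * X * Q = X}

/-- The orthogonal complement of a subspace of `L(H)` for the trace inner product
`⟨X, Y⟩ = tr (X* Y)`. -/
def traceOrthogonal [CompleteSpace H] (S : Submodule ℂ (H →L[ℂ] H)) :
    Submodule ℂ (H →L[ℂ] H) where
  carrier := {Y | ∀ X ∈ S, tr (star X * Y) = 0}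
  add_mem' := by
    intro a b ha hb X hX
    rw [mul_add, map_add, ha X hX, hb X hX, add_zero]
  zero_mem' := by
    intro X _
    rw [mul_zero, map_zero]
  smul_mem' := by
    intro c a ha X hX
    rw [mul_smul_comm, map_smul, ha X hX, smul_zero]

variable (H) in
/-- A quantum channel on `H`: a completely positive and trace-preserving linear map
`L(H) → L(H)`. -/
structure Channel [CompleteSpace H] extends
    CompletelyPositiveMap (H →L[ℂ] H) (H →L[ℂ] H) where
  trace_preserving : ∀ ρ : H →L[ℂ] H, tr (toLinearMap ρ) = tr ρ

/-- A subalgebra `A` of `L(QH)` is private for the channel `Φ` with respect to the projection `Q`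
if `P_Q ∘ Φ†` maps `L(H)` into the commutant of `A` in `L(QH)`. -/
def IsPrivate [CompleteSpace H] [FiniteDimensional ℂ H] (Φ : Channel H) (Q : H →L[ℂ] H)
    (A : NonUnitalSubalgebra ℂ (H →L[ℂ] H)) : Prop :=
  Set.range (compression Q ∘ₗ dualMap Φ.toLinearMap) ⊆
    {X | X ∈ compressedOperators Q ∧ ∀ a ∈ A, X * a = a * X}

end

end PrivateAlgebra

namespace PrivateAlgebra

section

variable {H : Type*} [NormedAddCommGroup H] [InnerProductSpace ℂ H]

/-! Since `P_Q` is self-dual for the pairing `tr (X Y)`, the map `P_Q ∘ Φ†` is the transpose of `Φ ∘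
P_Q`, so its range is the annihilator of `ker (Φ ∘ P_Q)`. This kernel is closed under adjoints, so
the annihilator is also its orthogonal complement for `tr (X* Y)`. Both sides of the equivalence
thus say that `A` commutes with the same set. -/

theorem compression_apply (Q X : H →L[ℂ] H) : compression Q X = Q * X * Q := rfl

theorem compression_mem_compressedOperators {Q : H →L[ℂ] H} (hQ : IsIdempotentElem Q)
    (X : H →L[ℂ] H) : compression Q X ∈ compressedOperators Q := by
  change Q * (Q * X * Q) * Q = Q * X * Q
  simp only [mul_assoc, hQ.eq]
  rw [← mul_assoc, hQ.eq]

/-- Compression by `Q` is self-dual for the trace pairing. -/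
theorem tr_compression_mul (Q X Y : H →L[ℂ] H) :
    tr (compression Q X * Y) = tr (X * compression Q Y) := by
  rw [compression_apply, compression_apply, mul_assoc, mul_assoc, tr_mul_comm]
  simp only [mul_assoc]

/-- The range of the dual map is the annihilator of the kernel for the trace pairing. -/
theorem mem_range_iff_of_tr_mul_eq [FiniteDimensional ℂ H]
    {Ψ T : (H →L[ℂ] H) →ₗ[ℂ] (H →L[ℂ] H)} (hT : ∀ ρ X, tr (Ψ ρ * X) = tr (ρ * T X))
    (Y : H →L[ℂ] H) : Y ∈ T.range ↔ ∀ X ∈ Ψ.ker, tr (X * Y) = 0 := by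
  constructor
  · rintro ⟨Z, rfl⟩ X hX
    rw [← hT, LinearMap.mem_ker.mp hX, zero_mul, map_zero]
  · intro hY
    let D := LinearMap.BilinForm.toDual (tracePairing (H := H)) tracePairing_nondegenerate
    have hD (A B : H →L[ℂ] H) : D A B = tr (B * A) := by
      rw [tr_mul_comm]
      exact LinearMap.BilinForm.toDual_def _
    -- `D` turns the claim into the duality of linear algebra: the range of a transpose is the
    -- annihilator of the kernel.
    have hmem : D Y ∈ Ψ.dualMap.range := by
      rw [LinearMap.range_dualMap_eq_dualAnnihilator_ker, Submodule.mem_dualAnnihilator]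
      intro X hX
      rw [hD, hY X hX]
    obtain ⟨g, hg⟩ := hmem
    refine ⟨D.symm g, D.injective <| LinearMap.ext fun ρ ↦ ?_⟩
    rw [hD, ← hT, ← hD, LinearEquiv.apply_symm_apply, ← hg, LinearMap.dualMap_apply]

variable [CompleteSpace H]

/-- The only use of complete positivity: positive maps preserve adjoints. -/
theorem Channel.map_star (Φ : Channel H) (X : H →L[ℂ] H) :
    Φ.toLinearMap (star X) = star (Φ.toLinearMap X) := by
  exact StarHomClass.map_star Φ.toCompletelyPositiveMap X

theorem star_mem_ker_comp_compression {Q : H →L[ℂ] H} (hQ : IsSelfAdjoint Q) (Φ : Channel H)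
    {X : H →L[ℂ] H} (hX : X ∈ LinearMap.ker (Φ.toLinearMap ∘ₗ compression Q)) :
    star X ∈ LinearMap.ker (Φ.toLinearMap ∘ₗ compression Q) := by
  have hstar : compression Q (star X) = star (compression Q X) := by
    simp only [compression_apply, star_mul, hQ.star_eq, mul_assoc]
  rw [LinearMap.mem_ker, LinearMap.comp_apply] at hX ⊢
  rw [hstar, Φ.map_star, hX, star_zero]

/-- The range of `P_Q ∘ Φ†` is the trace-orthogonal complement of `ker (Φ ∘ P_Q)`. -/
theorem range_compression_comp_dualMap [FiniteDimensional ℂ H] {Q : H →L[ℂ] H}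
    (hQ : IsSelfAdjoint Q) (Φ : Channel H) :
    (compression Q ∘ₗ dualMap Φ.toLinearMap).range =
      traceOrthogonal (LinearMap.ker (Φ.toLinearMap ∘ₗ compression Q)) := by
  ext Y
  rw [mem_range_iff_of_tr_mul_eq (Ψ := Φ.toLinearMap ∘ₗ compression Q) fun ρ X ↦ by
    rw [LinearMap.comp_apply, LinearMap.comp_apply, tr_mul_dualMap, tr_compression_mul]]
  -- Replacing `X` by `star X` inside the kernel exchanges the bilinear and sesquilinear conditions.
  refine ⟨fun h X hX ↦ h _ (star_mem_ker_comp_compression hQ Φ hX), fun h X hX ↦ ?_⟩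
  simpa only [star_star] using h _ (star_mem_ker_comp_compression hQ Φ hX)

end

end PrivateAlgebra

theorem mainTheorem2 {H : Type*} [NormedAddCommGroup H] [InnerProductSpace ℂ H]
    [CompleteSpace H] [FiniteDimensional ℂ H]
    (Q : H →L[ℂ] H) (hQ : IsStarProjection Q)
    (A : NonUnitalSubalgebra ℂ (H →L[ℂ] H))
    (hA : (A : Set (H →L[ℂ] H)) ⊆ PrivateAlgebra.compressedOperators Q)
    (Φ : PrivateAlgebra.Channel H) :
    PrivateAlgebra.IsPrivate Φ Q A ↔
      (A : Set (H →L[ℂ] H)) ⊆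
        Set.centralizer
          (PrivateAlgebra.traceOrthogonal
            (LinearMap.ker (Φ.toLinearMap ∘ₗ PrivateAlgebra.compression Q)) :
              Set (H →L[ℂ] H)) := by
  rw [← PrivateAlgebra.range_compression_comp_dualMap hQ.isSelfAdjoint, LinearMap.coe_range]
  -- Lying in the corner is automatic for compressed operators, so only commutation has content.
  refine ⟨fun h a ha X hX ↦ (h hX).2 a ha, fun h X hX ↦ ⟨?_, fun a ha ↦ h ha X hX⟩⟩
  obtain ⟨Z, rfl⟩ := hX
  exact PrivateAlgebra.compression_mem_compressedOperators hQ.isIdempotentElem _
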